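/- Let $K$ be a field, let $L_n$ be the path graph with vertices $1,\dots,n$ and edges $\{i,i+1\}$ for $1\le i\le n-1$, and let $I=I(L_n)=(x_ix_{i+1} : 1\le i\le n-1)\subset S=K[x_1,\dots,x_n]$ be its edge ideal. For $k\ge 1$ let $I^{[k]}$ be the $k$-th square-free power of $I$, i.e. the ideal generated by all square-free monomials in $I^k$. For a graded ideal $J\subsetneq\mathfrak m=(x_1,\dots,x_n)$ let $$\mathrm{v}(J)=\min\{d\ge 1 : \exists\, f\in S_d \text{ and } \mathfrak p\in \mathrm{Ass}(S/J)\text{ such that } (J:f)=\mathfrak p\},$$ and $\mathrm{v}(\mathfrak m)=0$. Let $\mathrm{match}(L_n)$ be the maximum number of edges in a matching of $L_n$. Then for every $1\le k\le \mathrm{match}(L_n)$: 1. if $k$ is odd, then $$\mathrm{v}(I^{[k]})=\begin{cases}\left\lfloor \frac n4\right\rfloor+\frac{3(k-1)}2, & n\equiv 0,1 \pmod 4,\\[2pt] \left\lfloor \frac n4\right\rfloor+\frac{3(k-1)}2+1, & n\equiv 2,3 \pmod 4;\end{cases}$$ 2. if $k$ is even, then $$\mathrm{v}(I^{[k]})=\left\lfloor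 \frac n4\right\rfloor+\frac{3k}2-1.$$ -/

import Mathlib

open MvPolynomial

noncomputable section

/-- The edge ideal `I(G)` in `K[x_v : v ∈ V]`, generated by the monomials `x_u x_v`, where `{u, v}`
runs over the edges of `G`. -/
def edgeIdeal (K : Type*) [Field K] {V : Type*} (G : SimpleGraph V) : Ideal (MvPolynomial V K) :=
  Ideal.span {p | ∃ u v : V, G.Adj u v ∧ p = X u * X v}

/-- The `k`-th square-free power `I^[k]`: the ideal generated by all square-free monomials
that lie in `I ^ k`. -/
def squareFreePower {K : Type*} [Field K] {σ : Type*} (I : Ideal (MvPolynomial σ K)) (k : ℕ) :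
    Ideal (MvPolynomial σ K) :=
  Ideal.span {p | ∃ s : σ →₀ ℕ, (∀ i, s i ≤ 1) ∧ p = monomial s 1 ∧ p ∈ I ^ k}

/-- The maximal ideal `𝔪` generated by all variables. -/
def variablesIdeal (K : Type*) [Field K] (σ : Type*) : Ideal (MvPolynomial σ K) :=
  Ideal.span (Set.range X)

/-- The degrees `d ≥ 1` of homogeneous polynomials `f` such that `(I : f)` is an associated prime
of `S/I`. -/
def vDegrees {K : Type*} [Field K] {σ : Type*} (I : Ideal (MvPolynomial σ K)) : Set ℕ :=
  {d | 1 ≤ d ∧ ∃ f : MvPolynomial σ K, f.IsHomogeneous d ∧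
    ∃ P ∈ associatedPrimes (MvPolynomial σ K) (MvPolynomial σ K ⧸ I),
      Submodule.colon I {f} = P}

open Classical in
/-- The v-number of a graded ideal `I`: zero if `I = 𝔪`, and otherwise the minimum of
`vDegrees I`. All elements of `vDegrees I` are positive and `sInf ∅ = 0` in `ℕ`, so an equation
`vNumber I = d` with `d` positive says that the minimum exists and equals `d`. -/
def vNumber {K : Type*} [Field K] {σ : Type*} (I : Ideal (MvPolynomial σ K)) : ℕ :=
  if I = variablesIdeal K σ then 0 else sInf (vDegrees I)

/-- The matching number of a finite graph: the largest number of edges in a matching. -/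
def matchingNumber {V : Type*} [Finite V] (G : SimpleGraph V) : ℕ :=
  sSup {m | ∃ M : G.Subgraph, M.IsMatching ∧ M.edgeSet.ncard = m}

end

/-! Both parities give $2k-2+\lfloor (n+4-2k)/4\rfloor$. Membership in $I^{[k]}$ only asks that the
support of every monomial carry a $k$-matching (`mem_squareFreePower_iff`), so the v-number becomes
a question about vertex sets of a path.

Lower bound: let $(I^{[k]}:f)=P$ be prime, $T$ the support of a monomial of $f$ outside $I^{[k]}$,
and $N$ the set of variables in $P$. Then $T$ has no $k$-matching, $T\cup\{c\}$ has one for every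
$c\in N$, and the complement of $N$ has none. The last fact forces $|N|\ge (n+1-2k)/2$
(`HasPathMatching.exists_range_sdiff`); the first two give $|N|+4(k-1)\le 2|T|$
(`HasPathMatching.card_le_of_forall_insert`), by gluing maximum matchings. Finally $\deg f\ge |T|$.

Upper bound: $f=x^T$, where $T$ is the initial $2k-2$ vertices plus isolated vertices, mostly 4
apart, whose neighbours meet every edge of the rest (`exists_card_upper_bound`). The colon ideal is
then generated by variables. -/

/-- The path on the vertices in `T ⊆ ℕ` (with edges `{i, i + 1}`) has a matching with `k` edges;
an edge is represented by its smaller endpoint. -/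
def HasPathMatching (T : Finset ℕ) (k : ℕ) : Prop :=
  ∃ M : Finset ℕ, M.card = k ∧ ∀ i ∈ M, i ∈ T ∧ i + 1 ∈ T ∧ i + 1 ∉ M

/-! ### Maximum matchings on subsets of a path -/

namespace HasPathMatching

variable {T T' : Finset ℕ} {j k : ℕ}

theorem mono (h : HasPathMatching T k) (hT : T ⊆ T') : HasPathMatching T' k := by
  obtain ⟨M, hM, h⟩ := h
  exact ⟨M, hM, fun i hi => ⟨hT (h i hi).1, hT (h i hi).2.1, (h i hi).2.2⟩⟩

theorem of_le (h : HasPathMatching T k) (hjk : j ≤ k) : HasPathMatching T j := by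
  obtain ⟨M, hM, h⟩ := h
  obtain ⟨M', hM', hc⟩ := Finset.exists_subset_card_eq (hjk.trans hM.ge)
  exact ⟨M', hc, fun i hi => ⟨(h i (hM' hi)).1, (h i (hM' hi)).2.1,
    fun hc => (h i (hM' hi)).2.2 (hM' hc)⟩⟩

theorem two_mul_le_card (h : HasPathMatching T k) : 2 * k ≤ T.card := by
  obtain ⟨M, rfl, h⟩ := h
  have hdisj : Disjoint M (M.image (· + 1)) := by
    rw [Finset.disjoint_left]
    intro a ha hb
    obtain ⟨b, hbM, rfl⟩ := Finset.mem_image.1 hb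
    exact (h b hbM).2.2 ha
  have hsub : M ∪ M.image (· + 1) ⊆ T := by
    intro a ha
    rcases Finset.mem_union.1 ha with ha | ha
    · exact (h a ha).1
    · obtain ⟨b, hb, rfl⟩ := Finset.mem_image.1 ha
      exact (h b hb).2.1
  have := Finset.card_le_card hsub
  rw [Finset.card_union_of_disjoint hdisj,
    Finset.card_image_of_injective _ (add_left_injective 1)] at this
  omega

/-- Two maximum matchings of the path on `T` can be exchanged at a vertex `c` outside `T`. -/
theorem glue (hT : ¬ HasPathMatching T (k + 1)) {c : ℕ} (hc : c ∉ T) {A B : Finset ℕ}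
    (hA : A ⊆ T) (hB : B ⊆ T) (hAk : HasPathMatching A k) (hBk : HasPathMatching B k) :
    HasPathMatching (A.filter (· < c) ∪ B.filter (c < ·)) k := by
  obtain ⟨M, hMk, hM⟩ := hAk
  obtain ⟨L, hLk, hL⟩ := hBk
  have key : ∀ (A B M L : Finset ℕ), A ⊆ T → B ⊆ T →
      (∀ i ∈ M, i ∈ A ∧ i + 1 ∈ A ∧ i + 1 ∉ M) → (∀ i ∈ L, i ∈ B ∧ i + 1 ∈ B ∧ i + 1 ∉ L) →
      HasPathMatching (A.filter (· < c) ∪ B.filter (c < ·))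
        ((M.filter (· < c)).card + (L.filter (c < ·)).card) := by
    intro A B M L hA hB hM hL
    refine ⟨M.filter (· < c) ∪ L.filter (c < ·), Finset.card_union_of_disjoint ?_, ?_⟩
    · rw [Finset.disjoint_left]
      intro a ha hb
      simp only [Finset.mem_filter] at ha hb
      omega
    · intro i hi
      simp only [Finset.mem_union, Finset.mem_filter] at hi ⊢
      rcases hi with ⟨hi, hic⟩ | ⟨hi, hic⟩
      · obtain ⟨h1, h2, h3⟩ := hM i hi
        have : i + 1 ≠ c := fun h => hc (h ▸ hA h2)
        exact ⟨Or.inl ⟨h1, hic⟩, Or.inl ⟨h2, by omega⟩, by rintro (⟨h, -⟩ | ⟨-, h⟩)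
                                                           · exact h3 h
                                                           · omega⟩
      · obtain ⟨h1, h2, h3⟩ := hL i hi
        exact ⟨Or.inr ⟨h1, hic⟩, Or.inr ⟨h2, by omega⟩, by rintro (⟨-, h⟩ | ⟨h, -⟩)
                                                           · omega
                                                           · exact h3 h⟩
  have split : ∀ (A M : Finset ℕ), A ⊆ T → (∀ i ∈ M, i ∈ A ∧ i + 1 ∈ A ∧ i + 1 ∉ M) →
      (M.filter (· < c)).card + (M.filter (c < ·)).card = M.card := by
    intro A M hA hM
    rw [← Finset.card_filter_add_card_filter_not (s := M) (· < c)]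
    congr 2
    refine Finset.filter_congr fun i hi => ?_
    have : i ≠ c := fun h => hc (h ▸ hA (hM i hi).1)
    omega
  have h1 := key A B M L hA hB hM hL
  have h2 := key B A L M hB hA hL hM
  have s1 := split A M hA hM
  have s2 := split B L hB hL
  refine h1.of_le ?_
  -- The two exchanged matchings have $2k$ edges in total, so if this one had fewer than $k$, the
  -- other would have more than $k$ inside $T$.
  by_contra hlt
  refine hT ((h2.of_le (j := k + 1) (by omega)).mono ?_)
  exact Finset.union_subset ((Finset.filter_subset _ _).trans hB)
    ((Finset.filter_subset _ _).trans hA)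

/-- Vertices missed one at a time can be missed all at once: glue at the gap `d + 1` after the least
`d`, using its own matching below and the inductive one above. -/
theorem sdiff_of_forall_left (hT : ¬ HasPathMatching T (k + 1)) (hk : HasPathMatching T k)
    (S : Finset ℕ) (hS : ∀ d ∈ S, d + 1 ∉ T ∧ HasPathMatching (T.erase d) k) :
    HasPathMatching (T \ S) k := by
  induction S using Finset.induction_on_min with
  | empty => simpa using hk
  | insert d S hd ih =>
    obtain ⟨h1, h2⟩ := hS d (Finset.mem_insert_self _ _)
    refine (glue hT h1 (Finset.erase_subset d T) Finset.sdiff_subset h2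
      (ih fun e he => hS e (Finset.mem_insert_of_mem he))).mono ?_
    intro x hx
    simp only [Finset.mem_union, Finset.mem_filter, Finset.mem_erase, Finset.mem_sdiff,
      Finset.mem_insert] at hx ⊢
    rcases hx with ⟨⟨hx, hxT⟩, hlt⟩ | ⟨⟨hxT, hx⟩, hlt⟩
    · refine ⟨hxT, ?_⟩
      rintro (h | h)
      · exact hx h
      · have := hd x h
        omega
    · refine ⟨hxT, ?_⟩
      rintro (h | h)
      · omega
      · exact hx h

theorem sdiff_of_forall_right (hT : ¬ HasPathMatching T (k + 1)) (hk : HasPathMatching T k)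
    (S : Finset ℕ) (hS : ∀ c ∈ S, c ∉ T ∧ HasPathMatching (T.erase (c + 1)) k) :
    HasPathMatching (T \ S.image (· + 1)) k := by
  induction S using Finset.induction_on_max with
  | empty => simpa using hk
  | insert d S hd ih =>
    obtain ⟨h1, h2⟩ := hS d (Finset.mem_insert_self _ _)
    refine (glue hT h1 Finset.sdiff_subset (Finset.erase_subset (d + 1) T)
      (ih fun e he => hS e (Finset.mem_insert_of_mem he)) h2).mono ?_
    intro x hx
    simp only [Finset.mem_union, Finset.mem_filter, Finset.mem_erase, Finset.mem_sdiff,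
      Finset.mem_image, Finset.mem_insert, not_exists, not_and] at hx ⊢
    rcases hx with ⟨⟨hxT, hx⟩, hlt⟩ | ⟨⟨hx, hxT⟩, hlt⟩
    · refine ⟨hxT, ?_⟩
      rintro y (h | h)
      · omega
      · exact hx y h
    · refine ⟨hxT, ?_⟩
      rintro y (h | h)
      · omega
      · have := hd y h
        omega

/-- A matching using the new vertex `c` restricts to a matching of `T` avoiding a neighbour
of `c`. -/
theorem exists_erase_of_insert {c : ℕ} (hT : ¬ HasPathMatching T (k + 1))
    (h : HasPathMatching (insert c T) (k + 1)) :
    (∃ d ∈ T, d + 1 = c ∧ HasPathMatching (T.erase d) k) ∨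
      (c + 1 ∈ T ∧ HasPathMatching (T.erase (c + 1)) k) := by
  obtain ⟨M, hMk, hM⟩ := h
  have hrec : ∀ i ∈ M, ∀ d, i = c ∧ d = c + 1 ∨ i = d ∧ d + 1 = c →
      HasPathMatching (T.erase d) k := by
    intro i hi d hid
    refine ⟨M.erase i, by rw [Finset.card_erase_of_mem hi]; omega, fun j hj => ?_⟩
    obtain ⟨hji, hj⟩ := Finset.mem_erase.1 hj
    obtain ⟨h1, h2, h3⟩ := hM j hj
    obtain ⟨-, -, h6⟩ := hM i hi
    have h7 : j + 1 ≠ i := fun h => h3 (h ▸ hi)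
    have h8 : j ≠ i + 1 := fun h => h6 (h ▸ hj)
    simp only [Finset.mem_insert, Finset.mem_erase] at h1 h2 ⊢
    refine ⟨⟨by omega, h1.resolve_left (by omega)⟩, ⟨by omega, h2.resolve_left (by omega)⟩,
      fun h => h3 h.2⟩
  by_cases hcM : c ∈ M
  · refine Or.inr ⟨?_, hrec c hcM _ (Or.inl ⟨rfl, rfl⟩)⟩
    exact (Finset.mem_insert.1 (hM c hcM).2.1).resolve_left (by omega)
  by_cases hd : ∃ d ∈ M, d + 1 = c
  · obtain ⟨d, hdM, hdc⟩ := hd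
    exact Or.inl ⟨d, (Finset.mem_insert.1 (hM d hdM).1).resolve_left (by omega), hdc,
      hrec d hdM d (Or.inr ⟨rfl, hdc⟩)⟩
  · push Not at hd
    refine absurd ⟨M, hMk, fun i hi => ?_⟩ hT
    obtain ⟨h1, h2, h3⟩ := hM i hi
    exact ⟨(Finset.mem_insert.1 h1).resolve_left fun h => hcM (h ▸ hi),
      (Finset.mem_insert.1 h2).resolve_left (hd i hi), h3⟩

/-- Each vertex of `T` missed by a maximum matching accounts for at most two vertices `c` that
increase the matching number. -/
theorem card_le_of_forall_insert (hT : ¬ HasPathMatching T (k + 1)) (hk : HasPathMatching T k)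
    (N : Finset ℕ) (hN : ∀ c ∈ N, HasPathMatching (insert c T) (k + 1)) :
    N.card + 4 * k ≤ 2 * T.card := by
  classical
  have hNT : ∀ c ∈ N, c ∉ T := fun c hc h =>
    hT (by simpa [Finset.insert_eq_of_mem h] using hN c hc)
  -- `D` holds the missable left neighbours, `R` the `c` with a missable right neighbour. Each
  -- family can be missed simultaneously, so has at most $|T|-2k$ members, and together they account
  -- for `N`.
  set D := T.filter fun d => d + 1 ∉ T ∧ HasPathMatching (T.erase d) k with hD
  set R := N.filter fun c => c + 1 ∈ T ∧ HasPathMatching (T.erase (c + 1)) k with hR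
  have hDc := (sdiff_of_forall_left hT hk D fun d hd => (Finset.mem_filter.1 hd).2).two_mul_le_card
  have hRc := (sdiff_of_forall_right hT hk R fun c hc =>
    ⟨hNT c (Finset.mem_filter.1 hc).1, (Finset.mem_filter.1 hc).2.2⟩).two_mul_le_card
  have hDT : D ⊆ T := Finset.filter_subset _ _
  have hRT : R.image (· + 1) ⊆ T := by
    intro x hx
    obtain ⟨c, hc, rfl⟩ := Finset.mem_image.1 hx
    exact (Finset.mem_filter.1 hc).2.1
  rw [Finset.card_sdiff_of_subset hDT] at hDc
  rw [Finset.card_sdiff_of_subset hRT,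
    Finset.card_image_of_injective _ (add_left_injective 1)] at hRc
  have h1 := Finset.card_le_card hDT
  have h2 := Finset.card_le_card hRT
  rw [Finset.card_image_of_injective _ (add_left_injective 1)] at h2
  have hcov : N ⊆ D.image (· + 1) ∪ R := by
    intro c hc
    rcases exists_erase_of_insert hT (hN c hc) with ⟨d, hdT, rfl, hd⟩ | h
    · exact Finset.mem_union_left _ (Finset.mem_image_of_mem _
        (Finset.mem_filter.2 ⟨hdT, hNT _ hc, hd⟩))
    · exact Finset.mem_union_right _ (Finset.mem_filter.2 ⟨hc, h⟩)
  have h3 := Finset.card_le_card hcov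
  have h4 := Finset.card_union_le (D.image (· + 1)) R
  rw [Finset.card_image_of_injective _ (add_left_injective 1)] at h4
  have h5 := hk.two_mul_le_card
  omega

/-- Deleting a set `N` of vertices from a path leaves a matching that misses at most
`|N| + 1` of the remaining vertices. -/
theorem exists_range_sdiff (N : Finset ℕ) (n : ℕ) :
    ∃ m, HasPathMatching (Finset.range n \ N) m ∧
      n ≤ 2 * m + 2 * (N.filter (· < n)).card + 1 := by
  induction n using Nat.twoStepInduction with
  | zero => exact ⟨0, ⟨∅, by simp⟩, by omega⟩
  | one => exact ⟨0, ⟨∅, by simp⟩, by omega⟩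
  | more n ih _ =>
    obtain ⟨m, hm, hle⟩ := ih
    have hfil : N.filter (· < n) ⊆ N.filter (· < n + 2) :=
      Finset.monotone_filter_right _ fun a ha => by omega
    -- The pair $\{n,n+1\}$ either meets `N` or is a new edge; the final $+1$ pays for an unpaired
    -- vertex when the length is odd.
    by_cases hN : n ∈ N ∨ n + 1 ∈ N
    · refine ⟨m, hm.mono (Finset.sdiff_subset_sdiff (by simp) le_rfl), ?_⟩
      have : (N.filter (· < n)).card < (N.filter (· < n + 2)).card := by
        refine Finset.card_lt_card ((Finset.ssubset_iff_of_subset hfil).2 ?_)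
        rcases hN with h | h
        · exact ⟨n, by simp [h], by simp⟩
        · exact ⟨n + 1, by simp [h], by simp⟩
      omega
    · push Not at hN
      obtain ⟨M, hMm, hM⟩ := hm
      have hlt : ∀ i ∈ M, i + 1 < n := fun i hi => by
        have := (hM i hi).2.1
        simp only [Finset.mem_sdiff, Finset.mem_range] at this
        exact this.1
      refine ⟨m + 1, ⟨insert n M, ?_, ?_⟩, ?_⟩
      · rw [Finset.card_insert_of_notMem (fun h => by have := hlt n h; omega), hMm]
      · intro i hi
        simp only [Finset.mem_insert, Finset.mem_sdiff, Finset.mem_range] at hi hM ⊢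
        rcases hi with rfl | hi
        · refine ⟨⟨by omega, hN.1⟩, ⟨by omega, hN.2⟩, ?_⟩
          rintro (h | h)
          · omega
          · have := hlt _ h
            omega
        · obtain ⟨h1, h2, h3⟩ := hM i hi
          refine ⟨⟨by omega, h1.2⟩, ⟨by omega, h2.2⟩, ?_⟩
          rintro (h | h)
          · omega
          · exact h3 h
      · have := Finset.card_le_card hfil
        omega

end HasPathMatching

/-! ### The extremal vertex sets -/

theorem card_lower_bound {n k : ℕ} (hk : 1 ≤ k) (hkn : 2 * k ≤ n) {T N : Finset ℕ}
    (hT : ¬ HasPathMatching T k) (hN : ∀ c ∈ N, HasPathMatching (insert c T) k)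
    (hNc : ¬ HasPathMatching (Finset.range n \ N) k) :
    2 * k - 2 + (n + 4 - 2 * k) / 4 ≤ T.card := by
  obtain ⟨k, rfl⟩ := Nat.exists_eq_succ_of_ne_zero (by omega : k ≠ 0)
  obtain ⟨m, hm, hle⟩ := HasPathMatching.exists_range_sdiff N n
  have hmk : m ≤ k := by
    by_contra h
    exact hNc (hm.of_le (by omega))
  have hcard := Finset.card_le_card (Finset.filter_subset (· < n) N)
  obtain ⟨c, hc⟩ : N.Nonempty := by
    rw [← Finset.card_pos]
    omega
  have hTk : HasPathMatching T k := by
    rcases HasPathMatching.exists_erase_of_insert hT (hN c hc) with ⟨d, -, -, h⟩ | ⟨-, h⟩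
    · exact h.mono (Finset.erase_subset _ _)
    · exact h.mono (Finset.erase_subset _ _)
  have := HasPathMatching.card_le_of_forall_insert hT hTk N hN
  omega

/-- A matching whose edges all start below `2 * j` has at most `j` edges. -/
theorem card_le_of_forall_lt {M : Finset ℕ} {j : ℕ} (hM : ∀ i ∈ M, i + 1 ∉ M)
    (hlt : ∀ i ∈ M, i < 2 * j) : M.card ≤ j := by
  rw [← Finset.card_range j]
  refine Finset.card_le_card_of_injOn (· / 2) (fun i hi => ?_) fun a ha b hb hab => ?_
  · have := hlt i hi
    simp only [Finset.coe_range, Set.mem_Iio]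
    omega
  · have h1 : a + 1 ≠ b := fun h => hM a ha (h ▸ hb)
    have h2 : b + 1 ≠ a := fun h => hM b hb (h ▸ ha)
    simp only at hab
    omega

theorem exists_card_upper_bound {n k : ℕ} (hk : 1 ≤ k) (hkn : 2 * k ≤ n) :
    ∃ T : Finset ℕ, T ⊆ Finset.range n ∧ 1 ≤ T.card ∧
      T.card ≤ 2 * k - 2 + (n + 4 - 2 * k) / 4 ∧ ¬ HasPathMatching T k ∧
      ∀ A : Finset ℕ, A ⊆ Finset.range n → HasPathMatching A k →
        ∃ c ∈ A, HasPathMatching (insert c T) k := by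
  classical
  obtain ⟨k, rfl⟩ := Nat.exists_eq_succ_of_ne_zero (by omega : k ≠ 0)
  set r := (n + 4 - 2 * k.succ) / 4 with hr
  -- After the gap at $2k$, one point per four vertices; the `min` pulls the last one back to $n-1$
  -- when it would overshoot.
  set p : ℕ → ℕ := fun j => 2 * k + min (2 + 4 * j) (n - 2 * k - 1) with hp
  set T := Finset.range (2 * k) ∪ (Finset.range r).image p with hTdef
  have hmem : ∀ x, x ∈ T ↔ x < 2 * k ∨ x < n ∧ 2 * k < x ∧
      ((x - 2 * k) % 4 = 2 ∨ x = n - 1 ∧ (n - 2 * k) % 4 = 2) := by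
    intro x
    simp only [hTdef, Finset.mem_union, Finset.mem_range, Finset.mem_image, hp]
    refine or_congr_right ⟨?_, ?_⟩
    · rintro ⟨j, hj, rfl⟩
      omega
    · rintro ⟨h1, h2, h3⟩
      refine ⟨(x - 2 * k - 1) / 4, ?_, ?_⟩ <;> omega
  have hT : ∀ M : Finset ℕ, (∀ i ∈ M, i + 1 ∉ M) → (∀ i ∈ M, i < 2 * k) → M.card ≠ k + 1 := by
    intro M h1 h2 h3
    have := card_le_of_forall_lt h1 h2
    omega
  refine ⟨T, ?_, ?_, ?_, ?_, ?_⟩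
  · intro x hx
    rw [hmem] at hx
    rw [Finset.mem_range]
    omega
  -- For the empty initial segment, `p 0` still secures the positive degree that `vDegrees` demands.
  · refine Finset.card_pos.2 ⟨p 0, Finset.mem_union_right _ (Finset.mem_image_of_mem _ ?_)⟩
    rw [Finset.mem_range]
    omega
  · refine (Finset.card_union_le _ _).trans ?_
    have := Finset.card_image_le (s := Finset.range r) (f := p)
    simp only [Finset.card_range] at this ⊢
    omega
  · rintro ⟨M, hMk, hM⟩
    refine hT M (fun i hi => (hM i hi).2.2) (fun i hi => ?_) hMk
    obtain ⟨h1, h2, -⟩ := hM i hi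
    rw [hmem] at h1 h2
    omega
  · rintro A hA ⟨M, hMk, hM⟩
    by_contra! hcon
    have hin : ∀ c, 2 * k ≤ c → c ∉ T → (c + 1 ∈ T ∨ ∃ d, d + 1 = c ∧ 2 * k ≤ d ∧ d ∈ T) →
        HasPathMatching (insert c T) (k + 1) := by
      intro c hc hcT h
      obtain ⟨e, he, hee⟩ : ∃ e, 2 * k ≤ e ∧ e ∈ insert c T ∧ e + 1 ∈ insert c T := by
        rcases h with h | ⟨d, rfl, hd, hdT⟩
        · exact ⟨c, hc, by simp [h]⟩
        · exact ⟨d, hd, by simp [hdT]⟩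
      refine ⟨insert e ((Finset.range k).image (2 * ·)), ?_, ?_⟩
      · rw [Finset.card_insert_of_notMem, Finset.card_image_of_injective, Finset.card_range]
        · intro a b hab
          simpa using hab
        · simp only [Finset.mem_image, Finset.mem_range, not_exists, not_and]
          omega
      · intro i hi
        simp only [Finset.mem_insert, Finset.mem_image, Finset.mem_range, hmem] at hi hee ⊢
        rcases hi with rfl | ⟨a, ha, rfl⟩
        · refine ⟨hee.1, hee.2, ?_⟩
          rintro (h | ⟨a, ha, h⟩) <;> omega
        · refine ⟨by omega, by omega, ?_⟩
          rintro (h | ⟨b, hb, h⟩) <;> omega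
    refine hT M (fun i hi => (hM i hi).2.2) (fun i hi => ?_) hMk
    by_contra! hik
    obtain ⟨h1, h2, -⟩ := hM i hi
    have h3 : i + 1 < n := Finset.mem_range.1 (hA h2)
    have n1 : i ∉ T → i + 1 ∈ T → False := fun h h' => hcon i h1 (hin i hik h (Or.inl h'))
    have n2 : i + 1 ∉ T → i + 2 ∈ T ∨ i ∈ T → False := fun h h' =>
      hcon (i + 1) h2 (hin (i + 1) (by omega) h (h'.imp_right fun h' => ⟨i, rfl, hik, h'⟩))
    have m0 := hmem i
    have m1 := hmem (i + 1)
    have m2 := hmem (i + 2)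
    -- Points of `T` sit at residue 2, apart from a clamped last one at residue 1, so one end of
    -- each edge is a neighbour of a point.
    obtain h | h | h | h : (i - 2 * k) % 4 = 0 ∨ (i - 2 * k) % 4 = 1 ∨ (i - 2 * k) % 4 = 2 ∨
        (i - 2 * k) % 4 = 3 := by omega
    · by_cases h4 : i + 1 ∈ T
      · exact n1 (m0.not.2 (by omega)) h4
      · have h5 := m1.not.1 h4
        exact n2 h4 (Or.inl (m2.2 (by omega)))
    · exact n1 (m0.not.2 (by omega)) (m1.2 (by omega))
    · exact n2 (m1.not.2 (by omega)) (Or.inr (m0.2 (by omega)))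
    · exact hcon i h1 (hin i hik (m0.not.2 (by omega))
        (Or.inr ⟨i - 1, by omega, by omega, (hmem _).2 (by omega)⟩))

/-! ### Bounding the matching number -/

theorem edgeSet_ncard_le_of_isMatching {V : Type*} [Fintype V] {G : SimpleGraph V}
    {M : G.Subgraph} (hM : M.IsMatching) : 2 * M.edgeSet.ncard ≤ Fintype.card V := by
  classical
  have h1 : M.edgeSet.ncard ≤ M.coe.edgeFinset.card := by
    rw [← M.image_coe_edgeSet_coe, ← Set.ncard_coe_finset, SimpleGraph.coe_edgeFinset]
    exact Set.ncard_image_le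
  have h2 := M.coe.sum_degrees_eq_twice_card_edges
  rw [SimpleGraph.Subgraph.isMatching_iff_forall_degree] at hM
  have hdeg : ∀ v : M.verts, M.coe.degree v = 1 := fun v => by
    rw [← hM v v.2]
    convert M.coe_degree v
  have h4 : 2 * M.coe.edgeFinset.card = Fintype.card M.verts := by
    rw [← h2, ← Finset.card_univ, Finset.card_eq_sum_ones]
    exact Finset.sum_congr rfl fun v _ => by convert hdeg v
  have h3 := Fintype.card_subtype_le (· ∈ M.verts)
  exact ((Nat.mul_le_mul_left 2 h1).trans h4.le).trans h3

theorem two_mul_matchingNumber_le {V : Type*} [Fintype V] (G : SimpleGraph V) :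
    2 * matchingNumber G ≤ Fintype.card V := by
  have : matchingNumber G ≤ Fintype.card V / 2 := by
    refine csSup_le ⟨_, ⊥, fun v hv => hv.elim, rfl⟩ ?_
    rintro m ⟨M, hM, rfl⟩
    have := edgeSet_ncard_le_of_isMatching hM
    omega
  omega

/-! ### Monomials in powers of the edge ideal -/

/-- The support of an exponent vector, as a set of vertices in `ℕ`. -/
def natSupport {n : ℕ} (s : Fin n →₀ ℕ) : Finset ℕ :=
  s.support.map Fin.valEmbedding

theorem val_mem_natSupport {n : ℕ} {s : Fin n →₀ ℕ} {i : Fin n} :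
    (i : ℕ) ∈ natSupport s ↔ s i ≠ 0 := by
  simp [natSupport, Fin.val_inj]

theorem mem_natSupport {n : ℕ} {s : Fin n →₀ ℕ} {x : ℕ} :
    x ∈ natSupport s ↔ ∃ h : x < n, s ⟨x, h⟩ ≠ 0 := by
  constructor
  · intro h
    obtain ⟨i, -, rfl⟩ := Finset.mem_map.1 h
    exact ⟨i.2, val_mem_natSupport.1 h⟩
  · rintro ⟨h, hx⟩
    exact val_mem_natSupport.2 hx

theorem natSupport_mono {n : ℕ} {s t : Fin n →₀ ℕ} (h : s ≤ t) : natSupport s ⊆ natSupport t := by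
  intro x
  simp only [mem_natSupport]
  rintro ⟨hx, h0⟩
  have := h ⟨x, hx⟩
  exact ⟨hx, by omega⟩

section

open scoped Pointwise

variable (K : Type*) [Field K]

/-- The generators of the edge ideal of a path. -/
def pathEdges (n : ℕ) : Set (MvPolynomial (Fin n) K) :=
  {p | ∃ u v : Fin n, (SimpleGraph.pathGraph n).Adj u v ∧ p = X u * X v}

variable {K}

/-- A square-free product of edges repeats no vertex, so its factors form a matching. -/
theorem exists_monomial_of_mem_pathEdges_pow {n k : ℕ} {p : MvPolynomial (Fin n) K}
    (hp : p ∈ pathEdges K n ^ k) : ∃ e : Fin n →₀ ℕ, p = monomial e 1 ∧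
      ((∀ i, e i ≤ 1) → HasPathMatching (natSupport e) k) := by
  induction k generalizing p with
  | zero =>
    rw [pow_zero, Set.mem_one] at hp
    exact ⟨0, hp, fun _ => ⟨∅, by simp⟩⟩
  | succ k ih =>
    rw [pow_succ, Set.mem_mul] at hp
    obtain ⟨q, hq, _, ⟨u, v, huv, rfl⟩, rfl⟩ := hp
    obtain ⟨e, rfl, he⟩ := ih hq
    have key : ∀ a b : Fin n, (a : ℕ) + 1 = b →
        (∀ i, (e + (Finsupp.single a 1 + Finsupp.single b 1) : Fin n →₀ ℕ) i ≤ 1) →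
        HasPathMatching (natSupport (e + (Finsupp.single a 1 + Finsupp.single b 1))) (k + 1) := by
      intro a b hab h1
      simp only [Finsupp.add_apply] at h1
      have hne : a ≠ b := fun h => by
        rw [h] at hab
        omega
      have ha : e a = 0 := by
        have := h1 a
        rw [Finsupp.single_eq_same] at this
        omega
      have hb : e b = 0 := by
        have := h1 b
        rw [Finsupp.single_eq_same] at this
        omega
      obtain ⟨M, hMk, hM⟩ := he fun i => by
        have := h1 i
        omega
      have haS : (a : ℕ) ∉ natSupport e := fun h => val_mem_natSupport.1 h ha
      have hbS : (b : ℕ) ∉ natSupport e := fun h => val_mem_natSupport.1 h hb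
      have haM : (a : ℕ) ∉ M := fun h => haS (hM _ h).1
      refine ⟨insert (a : ℕ) M, by rw [Finset.card_insert_of_notMem haM, hMk], fun i hi => ?_⟩
      have hsub := natSupport_mono (self_le_add_right e (Finsupp.single a 1 + Finsupp.single b 1))
      rcases Finset.mem_insert.1 hi with rfl | hi
      · refine ⟨val_mem_natSupport.2 (by simp), ?_, ?_⟩
        · rw [hab]
          exact val_mem_natSupport.2 (by simp)
        · rw [Finset.mem_insert, hab]
          rintro (h | h)
          · omega
          · exact hbS (hM _ h).1
      · obtain ⟨h2, h3, h4⟩ := hM i hi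
        refine ⟨hsub h2, hsub h3, ?_⟩
        rw [Finset.mem_insert]
        rintro (h | h)
        · exact haS (h ▸ h3)
        · exact h4 h
    refine ⟨e + (Finsupp.single u 1 + Finsupp.single v 1), ?_, ?_⟩
    · simp [X, monomial_mul]
    · rcases SimpleGraph.pathGraph_adj.1 huv with h | h
      · exact key u v h
      · rw [add_comm (Finsupp.single u 1)]
        exact key v u h

theorem monomial_mem_edgeIdeal_pow {n k : ℕ} {s : Fin n →₀ ℕ}
    (h : HasPathMatching (natSupport s) k) :
    monomial s (1 : K) ∈ edgeIdeal K (SimpleGraph.pathGraph n) ^ k := by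
  induction k generalizing s with
  | zero => simp
  | succ k ih =>
    obtain ⟨M, hMk, hM⟩ := h
    obtain ⟨i, hi⟩ : M.Nonempty := by
      rw [← Finset.card_pos]
      omega
    obtain ⟨h1, h2, h3⟩ := hM i hi
    obtain ⟨hin, h1⟩ := mem_natSupport.1 h1
    obtain ⟨hin', h2⟩ := mem_natSupport.1 h2
    set t : Fin n →₀ ℕ := Finsupp.single ⟨i, hin⟩ 1 + Finsupp.single ⟨i + 1, hin'⟩ 1 with ht
    have hts : t ≤ s := by
      intro j
      simp only [ht, Finsupp.add_apply, Finsupp.single_apply]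
      split_ifs with h4 h5 h5
      · have := congrArg Fin.val (h4.trans h5.symm)
        simp at this
      · subst h4
        omega
      · subst h5
        omega
      · omega
    have hmono : monomial s (1 : K) = monomial (s - t) 1 *
        (X ⟨i, hin⟩ * X ⟨i + 1, hin'⟩) := by
      simp only [X, monomial_mul, mul_one]
      rw [← ht, tsub_add_cancel_of_le hts]
    rw [hmono, pow_succ]
    refine Ideal.mul_mem_mul (ih ?_) (Ideal.subset_span ⟨_, _, ?_, rfl⟩)
    · refine ⟨M.erase i, by rw [Finset.card_erase_of_mem hi]; omega, fun j hj => ?_⟩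
      obtain ⟨hji, hj⟩ := Finset.mem_erase.1 hj
      obtain ⟨h4, h5, h6⟩ := hM j hj
      have h7 : j + 1 ≠ i := fun h => h6 (h ▸ hi)
      have h8 : j ≠ i + 1 := fun h => h3 (h ▸ hj)
      have hst : ∀ x ∈ natSupport s, x ≠ i → x ≠ i + 1 → x ∈ natSupport (s - t) := by
        intro x hx hxi hxi'
        obtain ⟨hxn, hx⟩ := mem_natSupport.1 hx
        refine mem_natSupport.2 ⟨hxn, ?_⟩
        simpa [ht, Finsupp.single_apply, Ne.symm hxi, Ne.symm hxi'] using hx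
      exact ⟨hst j h4 hji h8, hst (j + 1) h5 h7 (by omega), fun h => h6 (Finset.mem_of_mem_erase h)⟩
    · exact SimpleGraph.pathGraph_adj.2 (Or.inl rfl)

theorem hasPathMatching_of_mem_edgeIdeal_pow {n k : ℕ} {s : Fin n →₀ ℕ} (hs : ∀ i, s i ≤ 1)
    (h : monomial s (1 : K) ∈ edgeIdeal K (SimpleGraph.pathGraph n) ^ k) :
    HasPathMatching (natSupport s) k := by
  have hspan : edgeIdeal K (SimpleGraph.pathGraph n) ^ k =
      Ideal.span ((fun e => monomial e (1 : K)) ''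
        {e : Fin n →₀ ℕ | monomial e (1 : K) ∈ pathEdges K n ^ k}) := by
    refine (Submodule.span_pow (R := MvPolynomial (Fin n) K) (pathEdges K n) k).trans
      (congrArg Ideal.span ?_)
    ext p
    constructor
    · intro hp
      obtain ⟨e, rfl, -⟩ := exists_monomial_of_mem_pathEdges_pow hp
      exact ⟨e, hp, rfl⟩
    · rintro ⟨e, he, rfl⟩
      exact he
  rw [hspan, mem_ideal_span_monomial_image] at h
  obtain ⟨e, he, hes⟩ := h s (by simp)
  obtain ⟨e', h1, h2⟩ := exists_monomial_of_mem_pathEdges_pow he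
  obtain rfl : e = e' := monomial_left_injective one_ne_zero h1
  exact (h2 fun i => (hes i).trans (hs i)).mono (natSupport_mono hes)

/-- Membership in a square-free power of the edge ideal of a path is decided by the supports of
the monomials. -/
theorem mem_squareFreePower_iff {n k : ℕ} {f : MvPolynomial (Fin n) K} :
    f ∈ squareFreePower (edgeIdeal K (SimpleGraph.pathGraph n)) k ↔
      ∀ u ∈ f.support, HasPathMatching (natSupport u) k := by
  classical
  have : squareFreePower (edgeIdeal K (SimpleGraph.pathGraph n)) k =
      Ideal.span ((fun e => monomial e (1 : K)) '' {s : Fin n →₀ ℕ | (∀ i, s i ≤ 1) ∧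
        monomial s (1 : K) ∈ edgeIdeal K (SimpleGraph.pathGraph n) ^ k}) := by
    refine congrArg Ideal.span ?_
    ext p
    constructor
    · rintro ⟨s, hs, rfl, h⟩
      exact ⟨s, ⟨hs, h⟩, rfl⟩
    · rintro ⟨s, ⟨hs, h⟩, rfl⟩
      exact ⟨s, hs, rfl, h⟩
  rw [this, mem_ideal_span_monomial_image]
  refine forall₂_congr fun u hu => ⟨?_, fun h => ?_⟩
  · rintro ⟨s, ⟨hs, h⟩, hsu⟩
    exact (hasPathMatching_of_mem_edgeIdeal_pow hs h).mono (natSupport_mono hsu)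
  -- The witness is the square-free part of `u`.
  · refine ⟨u.mapRange (min 1) (by simp), ⟨fun i => by simp, monomial_mem_edgeIdeal_pow ?_⟩,
      fun i => by simp⟩
    convert h using 1
    ext x
    simp [mem_natSupport]

/-! ### Colon ideals and the v-number -/

theorem isPrime_span_X_image {σ : Type*} (C : Set σ) :
    (Ideal.span (X '' C : Set (MvPolynomial σ K))).IsPrime := by
  classical
  -- Killing the variables in `C` changes a polynomial only modulo their span, so the span is the
  -- kernel of a map to a domain.
  set φ : MvPolynomial σ K →ₐ[K] MvPolynomial σ K := aeval fun i => if i ∈ C then 0 else X i with hφ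
  suffices h : Ideal.span (X '' C : Set (MvPolynomial σ K)) = RingHom.ker φ by
    rw [h]
    exact RingHom.ker_isPrime _
  refine le_antisymm (Ideal.span_le.2 ?_) fun g hg => ?_
  · rintro _ ⟨i, hi, rfl⟩
    simp [hφ, hi]
  · have hsub : ∀ g, g - φ g ∈ Ideal.span (X '' C : Set (MvPolynomial σ K)) := by
      intro g
      rw [← Ideal.Quotient.mk_eq_mk_iff_sub_mem]
      have : (Ideal.Quotient.mkₐ K (Ideal.span (X '' C : Set (MvPolynomial σ K)))) =
          (Ideal.Quotient.mkₐ K (Ideal.span (X '' C : Set (MvPolynomial σ K)))).comp φ := by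
        refine algHom_ext fun i => ?_
        by_cases hi : i ∈ C
        · simp only [AlgHom.comp_apply, hφ, aeval_X, if_pos hi, map_zero]
          exact Ideal.Quotient.eq_zero_iff_mem.2 (Ideal.subset_span ⟨i, hi, rfl⟩)
        · simp [hφ, hi]
      exact DFunLike.congr_fun this g
    simpa [(RingHom.mem_ker).1 hg] using hsub g

theorem mem_associatedPrimes_of_colon_eq {R : Type*} [CommRing R] {I P : Ideal R} (hP : P.IsPrime)
    {f : R} (h : Submodule.colon I {f} = P) : P ∈ associatedPrimes R (R ⧸ I) := by
  refine ⟨hP, Ideal.Quotient.mk I f, ?_⟩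
  have : Submodule.colon (⊥ : Submodule R (R ⧸ I)) {Ideal.Quotient.mk I f} = P := by
    rw [← h]
    ext g
    rw [Submodule.mem_colon_singleton, Submodule.mem_colon_singleton, Algebra.smul_def,
      Ideal.Quotient.algebraMap_eq, ← map_mul, Submodule.mem_bot, Ideal.Quotient.eq_zero_iff_mem,
      smul_eq_mul]
  rw [this, hP.radical]

theorem natSupport_add_single {n : ℕ} (u : Fin n →₀ ℕ) (c : Fin n) :
    natSupport (u + Finsupp.single c 1) = insert (c : ℕ) (natSupport u) := by
  ext x
  simp only [mem_natSupport, Finset.mem_insert, Finsupp.add_apply, Finsupp.single_apply]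
  constructor
  · rintro ⟨hx, h⟩
    by_cases hxc : x = c
    · exact Or.inl hxc
    · refine Or.inr ⟨hx, ?_⟩
      rwa [if_neg fun h => hxc (congrArg Fin.val h).symm, add_zero] at h
  · rintro (rfl | ⟨hx, h⟩)
    · exact ⟨c.2, by simp⟩
    · exact ⟨hx, by omega⟩

theorem le_of_mem_vDegrees {n k d : ℕ} (hk : 1 ≤ k) (hkn : 2 * k ≤ n)
    (hd : d ∈ vDegrees (squareFreePower (edgeIdeal K (SimpleGraph.pathGraph n)) k)) :
    2 * k - 2 + (n + 4 - 2 * k) / 4 ≤ d := by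
  classical
  obtain ⟨-, f, hf, P, hP, hfP⟩ := hd
  have hprime : P.IsPrime := hP.isPrime
  set I := squareFreePower (edgeIdeal K (SimpleGraph.pathGraph n)) k with hI
  have hmem : ∀ g, g ∈ P ↔ g * f ∈ I := fun g => by
    rw [← hfP, Submodule.mem_colon_singleton, smul_eq_mul]
  have hfI : f ∉ I := fun h => hprime.one_notMem ((hmem 1).2 (by rwa [one_mul]))
  rw [mem_squareFreePower_iff] at hfI
  push Not at hfI
  obtain ⟨u, hu, huk⟩ := hfI
  set N := (Finset.univ.filter fun c : Fin n => X c ∈ P).map Fin.valEmbedding with hN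
  refine (card_lower_bound (N := N) hk hkn huk ?_ ?_).trans ?_
  · intro c hc
    simp only [hN, Finset.mem_map, Finset.mem_filter, Finset.mem_univ, true_and] at hc
    obtain ⟨c, hc, rfl⟩ := hc
    rw [hmem, mem_squareFreePower_iff] at hc
    have := hc (u + Finsupp.single c 1) (by
      rw [mem_support_iff, mul_comm, coeff_mul_X]
      exact mem_support_iff.1 hu)
    rwa [natSupport_add_single] at this
  · intro h
    -- The product of all variables outside `P`: were it in $I^{[k]}\subseteq P$, primality would
    -- put one of them in `P`.
    set s : Fin n →₀ ℕ := Finsupp.equivFunOnFinite.symm fun i => if X i ∈ P then 0 else 1 with hs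
    have hsI : monomial s (1 : K) ∈ I := by
      rw [mem_squareFreePower_iff]
      intro v hv
      have hv' : v = s := by
        simpa [eq_comm] using hv
      subst hv'
      refine h.mono fun x hx => ?_
      simp only [Finset.mem_sdiff, Finset.mem_range, hN, Finset.mem_map, Finset.mem_filter,
        Finset.mem_univ, true_and, not_exists, not_and] at hx
      refine mem_natSupport.2 ⟨hx.1, ?_⟩
      have : X ⟨x, hx.1⟩ ∉ P := fun h => hx.2 _ h rfl
      simp [hs, this]
    have hsP : monomial s (1 : K) ∈ P := (hmem _).2 (Ideal.mul_mem_right _ _ hsI)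
    rw [monomial_eq, C_1, one_mul, Finsupp.prod, hprime.prod_mem_iff] at hsP
    obtain ⟨i, hi, hiP⟩ := hsP
    have := hprime.mem_of_pow_mem _ hiP
    rw [Finsupp.mem_support_iff] at hi
    simp [hs, this] at hi
  · rw [natSupport, Finset.card_map, ← hf (mem_support_iff.1 hu), Finsupp.weight_apply,
      Finsupp.sum, Finset.card_eq_sum_ones]
    refine Finset.sum_le_sum fun i hi => ?_
    have := Finsupp.mem_support_iff.1 hi
    simp only [Pi.one_apply, smul_eq_mul, mul_one]
    omega

theorem exists_mem_vDegrees_le {n k : ℕ} (hk : 1 ≤ k) (hkn : 2 * k ≤ n) :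
    ∃ d ∈ vDegrees (squareFreePower (edgeIdeal K (SimpleGraph.pathGraph n)) k),
      d ≤ 2 * k - 2 + (n + 4 - 2 * k) / 4 := by
  classical
  obtain ⟨T, hTn, hT1, hTle, hTk, hT⟩ := exists_card_upper_bound hk hkn
  set s : Fin n →₀ ℕ := Finsupp.equivFunOnFinite.symm fun i => if (i : ℕ) ∈ T then 1 else 0 with hs
  have hsT : natSupport s = T := by
    ext x
    rw [mem_natSupport]
    constructor
    · rintro ⟨hx, h⟩
      by_contra hxT
      simp [hs, hxT] at h
    · intro h
      exact ⟨Finset.mem_range.1 (hTn h), by simp [hs, h]⟩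
  have hdeg : s.degree = T.card := by
    rw [← hsT, natSupport, Finset.card_map, Finset.card_eq_sum_ones, Finsupp.degree]
    refine Finset.sum_congr rfl fun i hi => ?_
    rw [Finsupp.mem_support_iff] at hi
    by_cases h : (i : ℕ) ∈ T
    · simp [hs, h]
    · simp [hs, h] at hi
  set C : Set (Fin n) := {c | HasPathMatching (insert (c : ℕ) T) k} with hC
  have hCT : ∀ c ∈ C, (c : ℕ) ∉ T := fun c hc h => by
    rw [hC, Set.mem_ofPred_eq, Finset.insert_eq_of_mem h] at hc
    exact hTk hc
  have hcolon : Submodule.colon (squareFreePower (edgeIdeal K (SimpleGraph.pathGraph n)) k)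
      {monomial s 1} = Ideal.span (X '' C) := by
    ext g
    rw [Submodule.mem_colon_singleton, smul_eq_mul, mem_squareFreePower_iff,
      mem_ideal_span_X_image]
    constructor
    · intro h m hm
      have := h (m + s) (by
        rw [mem_support_iff, coeff_mul_monomial, mul_one]
        exact mem_support_iff.1 hm)
      obtain ⟨c, hc, hcT⟩ := hT _ (fun x hx => Finset.mem_range.2 (mem_natSupport.1 hx).1) this
      obtain ⟨hcn, hc⟩ := mem_natSupport.1 hc
      have hcC : (⟨c, hcn⟩ : Fin n) ∈ C := hcT
      refine ⟨⟨c, hcn⟩, hcC, ?_⟩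
      have := hCT _ hcC
      simpa [hs, this] using hc
    · intro h u hu
      rw [mem_support_iff, coeff_mul_monomial'] at hu
      split_ifs at hu with hsu
      · obtain ⟨c, hc, hcu⟩ := h (u - s) (by
          rw [mem_support_iff]
          simpa using hu)
        have hcC : HasPathMatching (insert (c : ℕ) T) k := hc
        refine hcC.mono (Finset.insert_subset (val_mem_natSupport.2 ?_)
          (hsT ▸ natSupport_mono hsu))
        rw [Finsupp.tsub_apply] at hcu
        omega
      · exact absurd rfl hu
  refine ⟨T.card, ⟨hT1, monomial s 1, hdeg ▸ isHomogeneous_monomial _ rfl,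
    Ideal.span (X '' C), mem_associatedPrimes_of_colon_eq (isPrime_span_X_image C) hcolon, hcolon⟩,
    hTle⟩

theorem vNumber_squareFreePower_pathGraph {n k : ℕ} (hk : 1 ≤ k) (hkn : 2 * k ≤ n) :
    vNumber (squareFreePower (edgeIdeal K (SimpleGraph.pathGraph n)) k) =
      2 * k - 2 + (n + 4 - 2 * k) / 4 := by
  have hne : squareFreePower (edgeIdeal K (SimpleGraph.pathGraph n)) k ≠
      variablesIdeal K (Fin n) := by
    intro h
    have hX : (X ⟨0, by omega⟩ : MvPolynomial (Fin n) K) ∈ variablesIdeal K (Fin n) :=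
      Ideal.subset_span ⟨_, rfl⟩
    rw [← h, mem_squareFreePower_iff] at hX
    have := (hX (Finsupp.single ⟨0, by omega⟩ 1) (by simp [X])).two_mul_le_card
    have h1 := Finsupp.support_single (⟨0, by omega⟩ : Fin n) (one_ne_zero (α := ℕ))
    rw [natSupport, Finset.card_map, h1, Finset.card_singleton] at this
    omega
  obtain ⟨d, hd, hle⟩ :=
    exists_mem_vDegrees_le (K := K) hk hkn
  rw [vNumber, if_neg hne]
  exact le_antisymm ((Nat.sInf_le hd).trans hle)
    (le_of_mem_vDegrees hk hkn (Nat.sInf_mem ⟨d, hd⟩))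

end

theorem mainTheorem6 (K : Type*) [Field K] (n k : ℕ) (hk : 1 ≤ k)
    (hkn : k ≤ matchingNumber (SimpleGraph.pathGraph n)) :
    (Odd k →
      ((n % 4 = 0 ∨ n % 4 = 1) →
        vNumber (squareFreePower (edgeIdeal K (SimpleGraph.pathGraph n)) k)
          = n / 4 + 3 * (k - 1) / 2) ∧
      ((n % 4 = 2 ∨ n % 4 = 3) →
        vNumber (squareFreePower (edgeIdeal K (SimpleGraph.pathGraph n)) k)
          = n / 4 + 3 * (k - 1) / 2 + 1)) ∧
    (Even k →
      vNumber (squareFreePower (edgeIdeal K (SimpleGraph.pathGraph n)) k)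
        = n / 4 + 3 * k / 2 - 1) := by
  have h2 := two_mul_matchingNumber_le (SimpleGraph.pathGraph n)
  rw [Fintype.card_fin] at h2
  have hn : 2 * k ≤ n := by omega
  rw [vNumber_squareFreePower_pathGraph hk hn]
  refine ⟨fun ⟨m, hm⟩ => ⟨fun h => ?_, fun h => ?_⟩, fun ⟨m, hm⟩ => ?_⟩ <;> omega
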